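/- Let $\mathbb{T}$ be the unit circle with normalized Lebesgue measure. For $p\in\{2,\infty\}$ let $H^p$ be the Hardy space, regarded through boundary values as the subspace of $L^p(\mathbb{T})$ of functions whose Fourier coefficients of negative index vanish; for $h\in H^\infty$, $h(0)$ denotes the value at $0$ of its holomorphic extension to the unit disk. For $\psi\in L^\infty(\mathbb{T})$ let $T_\psi:H^2\to H^2$ be the Toeplitz operator $T_\psi f=P_+(\psi f)$, where $P_+:L^2(\mathbb{T})\to H^2$ is the orthogonal projection. For $b\in H^\infty$ with $\|b\|_{H^\infty}\le 1$, the de Branges–Rovnyak space $\mathcal{H}(b)$ is the range of $A=(I-T_bT_{\overline b})^{1/2}$ on $H^2$, with the norm given by $\|Ag\|_{\mathcal{H}(b)}=\|g\|_{H^2}$ for $g\in H^2\ominus\ker A$. Theorem. Let $(h_n)$ be a sequence in $H^\infty$ such that $\|h_n\|_{H^\infty}\le 1$ for all $n$ and $\lim_{n\to\infty}h_n(0)=1$. Then, for every $b\in H^\infty$ with $\|b\|_{H^\infty}\le 1$ and every $f\in\mathcal{H}(b)$, we have $T_{\overline{h_n}}f\in\mathcal{H}(b)$ for all $n$, and $$\lim_{n\to\infty}\|T_{\overline{h_n}}f-f\|_{\mathcal{H}(b)}=0.$$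 -/

import Mathlib

open MeasureTheory Filter Topology
open scoped ENNReal

noncomputable section

namespace DBR

instance factTwoPiPos : Fact (0 < 2 * Real.pi) := ⟨Real.two_pi_pos⟩

/-- The unit circle, parametrized by the angle `θ` modulo `2π`; the monomial `fourier n` is
`θ ↦ exp (i n θ)`. -/
abbrev Torus : Type := AddCircle (2 * Real.pi)

/-- Normalized Lebesgue measure `dθ / 2π` on the circle. -/
abbrev torusMeasure : Measure Torus := AddCircle.haarAddCircle

/-- The space `L²` of the circle. -/
abbrev L2 : Type := Lp ℂ 2 torusMeasure

/-- The space `L^∞` of the circle, with the essential supremum norm. -/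
abbrev LInf : Type := Lp ℂ ∞ torusMeasure

theorem integrable_of_Lp {p : ℝ≥0∞} (hp : 1 ≤ p) (f : Lp ℂ p torusMeasure) :
    Integrable (f : Torus → ℂ) torusMeasure :=
  (Lp.memLp f).integrable hp

/-- For `1 ≤ p ≤ ∞`, the Hardy space `H^p`, identified through radial boundary values with the
subspace of those functions in `L^p` of the circle whose Fourier coefficients of negative index
all vanish. -/
def hardy (p : ℝ≥0∞) [hp : Fact (1 ≤ p)] : Submodule ℂ (Lp ℂ p torusMeasure) where
  carrier := {f | ∀ n : ℤ, n < 0 → fourierCoeff (f : Torus → ℂ) n = 0}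
  zero_mem' := by
    intro n _
    rw [fourierCoeff_congr_ae (Lp.coeFn_zero ℂ p torusMeasure)]
    simp [fourierCoeff]
  add_mem' := by
    intro f g hf hg n hn
    rw [fourierCoeff_congr_ae (Lp.coeFn_add f g),
      fourierCoeff.add (integrable_of_Lp hp.out f) (integrable_of_Lp hp.out g)]
    simp [hf n hn, hg n hn]
  smul_mem' := by
    intro c f hf n hn
    rw [fourierCoeff_congr_ae (Lp.coeFn_smul c f), fourierCoeff.const_smul]
    simp [hf n hn]

/-- The Hardy space `H²`, as a subspace of `L²` of the circle. -/
abbrev H2 : Submodule ℂ L2 := hardy 2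

/-- The space `H^∞`, as a subspace of `L^∞` of the circle. -/
abbrev HInf : Submodule ℂ LInf := hardy ∞

theorem isClosed_H2 : IsClosed (H2 : Set L2) := by
  have h : (H2 : Set L2) = ⋂ (n : ℤ) (_ : n < 0), {f : L2 | fourierBasis.repr f n = 0} := by
    ext f
    simp only [Set.mem_iInter, Set.mem_ofPred_eq, fourierBasis_repr]
    rfl
  rw [h]
  refine isClosed_iInter fun n => isClosed_iInter fun _ => ?_
  simp_rw [HilbertBasis.repr_apply_apply]
  exact isClosed_eq (by fun_prop) continuous_const

instance completeSpace_H2 : CompleteSpace H2 := isClosed_H2.completeSpace_coe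

/-- The value `h z` at a point `z` of the open unit disk of the holomorphic function with boundary
function `h`, computed from its Taylor series at the origin. -/
def evalDisk (h : HInf) (z : ℂ) : ℂ :=
  ∑' n : ℕ, fourierCoeff ((h : LInf) : Torus → ℂ) (n : ℤ) * z ^ n

/-- Multiplication by a function `ψ ∈ L^∞`, as a bounded operator on `L²`. -/
def mulOp (ψ : LInf) : L2 →L[ℂ] L2 :=
  (ContinuousLinearMap.mul ℂ ℂ).holderL torusMeasure ∞ 2 2 ψ

/-- The Toeplitz operator `T_ψ f = P₊ (ψ f)` on `H²`, where `P₊` is the orthogonal projection of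
`L²` onto `H²`. -/
def toeplitz (ψ : LInf) : H2 →L[ℂ] H2 :=
  H2.orthogonalProjectionOnto ∘L mulOp ψ ∘L H2.subtypeL

section RangeSpace

variable {H : Type*} [NormedAddCommGroup H] [InnerProductSpace ℂ H] [CompleteSpace H]

/-- The positive square root `A^{1/2}` of a bounded positive operator `A` on a Hilbert space. -/
def sqrtOp (A : H →L[ℂ] H) : H →L[ℂ] H := CFC.sqrt A

/-- The range of a bounded operator `A`; a separate type, because it carries
the norm for which `A` is a partial isometry onto it, not the norm of `H`. -/
def RangeSpace (A : H →L[ℂ] H) : Type _ := LinearMap.range (A : H →ₗ[ℂ] H)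

namespace RangeSpace

instance addCommGroup (A : H →L[ℂ] H) : AddCommGroup (RangeSpace A) :=
  inferInstanceAs (AddCommGroup (LinearMap.range (A : H →ₗ[ℂ] H)))

instance module (A : H →L[ℂ] H) : Module ℂ (RangeSpace A) :=
  inferInstanceAs (Module ℂ (LinearMap.range (A : H →ₗ[ℂ] H)))

/-- An element of the range space, as a vector of `H`. -/
def val {A : H →L[ℂ] H} (f : RangeSpace A) : H :=
  Subtype.val (p := fun x => x ∈ LinearMap.range (A : H →ₗ[ℂ] H)) f

/-- A vector in the range of `A`, as an element of the range space. -/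
def mk {A : H →L[ℂ] H} (f : H) (hf : f ∈ LinearMap.range (A : H →ₗ[ℂ] H)) : RangeSpace A :=
  ⟨f, hf⟩

/-- `A`, restricted to the orthogonal complement of its kernel, as a map onto its range. -/
def coimageMap (A : H →L[ℂ] H) :
    (LinearMap.ker (A : H →ₗ[ℂ] H))ᗮ →ₗ[ℂ] RangeSpace A :=
  (A : H →ₗ[ℂ] H).rangeRestrict.domRestrict (LinearMap.ker (A : H →ₗ[ℂ] H))ᗮ

theorem bijective_coimageMap (A : H →L[ℂ] H) : Function.Bijective (coimageMap A) := by
  have hc : IsClosed ((LinearMap.ker (A : H →ₗ[ℂ] H) : Submodule ℂ H) : Set H) :=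
    A.isClosed_ker
  have : CompleteSpace (LinearMap.ker (A : H →ₗ[ℂ] H)) := hc.completeSpace_coe
  constructor
  · rw [← LinearMap.ker_eq_bot, LinearMap.ker_eq_bot']
    intro g hg
    have hA : A (g : H) = 0 := congrArg val hg
    have hker : (g : H) ∈ LinearMap.ker (A : H →ₗ[ℂ] H) := hA
    exact Subtype.ext (inner_self_eq_zero.mp (g.2 _ hker))
  · rintro ⟨_, x, rfl⟩
    obtain ⟨y, hy, z, hz, rfl⟩ :=
      (LinearMap.ker (A : H →ₗ[ℂ] H)).exists_add_mem_mem_orthogonal x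
    refine ⟨⟨z, hz⟩, Subtype.ext ?_⟩
    have hy0 : A y = 0 := hy
    change A z = A (y + z)
    rw [map_add, hy0, zero_add]

/-- The linear bijection `(ker A)ᗮ ≃ range A` given by `A`. -/
def coimageEquiv (A : H →L[ℂ] H) :
    (LinearMap.ker (A : H →ₗ[ℂ] H))ᗮ ≃ₗ[ℂ] RangeSpace A :=
  LinearEquiv.ofBijective (coimageMap A) (bijective_coimageMap A)

/-- The range norm: `‖A g‖ = ‖g‖` for `g` orthogonal to the kernel of `A`. -/
instance normedAddCommGroup (A : H →L[ℂ] H) : NormedAddCommGroup (RangeSpace A) :=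
  NormedAddCommGroup.induced (RangeSpace A) (LinearMap.ker (A : H →ₗ[ℂ] H))ᗮ
    (coimageEquiv A).symm (coimageEquiv A).symm.injective

theorem norm_coimageMap (A : H →L[ℂ] H) (g : (LinearMap.ker (A : H →ₗ[ℂ] H))ᗮ) :
    ‖coimageMap A g‖ = ‖(g : H)‖ := by
  change ‖(coimageEquiv A).symm (coimageEquiv A g)‖ = ‖g‖
  rw [LinearEquiv.symm_apply_apply]

end RangeSpace

end RangeSpace

/-- The operator `(I - T_b T_b̄)^{1/2}` on `H²`. -/
def defectOp (b : HInf) : H2 →L[ℂ] H2 :=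
  sqrtOp (1 - toeplitz (b : LInf) * toeplitz (star (b : LInf)))

/-- The de Branges–Rovnyak space `H(b)`: the range of `(I - T_b T_b̄)^{1/2}`, with the norm that
makes this operator a partial isometry of `H²` onto `H(b)`. -/
abbrev DeBrangesRovnyak (b : HInf) : Type := RangeSpace (defectOp b)

/-- `H(b)` as a linear subspace of `H²`. -/
def deBrangesRovnyakSubmodule (b : HInf) : Submodule ℂ H2 :=
  LinearMap.range (defectOp b : H2 →ₗ[ℂ] H2)

end DBR

end

/-! Write `A` for the defect operator and `S_n = T_{h_n}`. With `P₋` the projection onto the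
complement of `H²`, `‖A g‖² = (‖g‖² - ‖b̄ g‖²) + ‖P₋ (b̄ g)‖²`, and multiplying `g` by `h_n`
increases neither term, the second because `H²` is invariant under `h_n`. So `‖A S_n g‖ ≤ ‖A g‖`,
which gives `A S_n = C_n A` for contractions `C_n`, and dually `S_n* A = A C_n*`. As `h_n(0) → 1`
and `‖h_n‖ ≤ 1`, `S_n → 1` strongly, hence `C_n → 1` on the closure of the range of `A`. For
contractions this passes to the adjoints: `C_n* y → y`, that is, `S_n* A y → A y` in the range
norm. -/

open scoped InnerProductSpace InnerProduct

namespace DBR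

section Operators

variable {𝕜 : Type*} [RCLike 𝕜] {ι : Type*} {l : Filter ι}

section Normed

variable {E F : Type*} [NormedAddCommGroup E] [NormedSpace 𝕜 E]
  [NormedAddCommGroup F] [NormedSpace 𝕜 F]

theorem tendsto_apply_of_mem_closure_span {T : ι → E →L[𝕜] F} {T₀ : E →L[𝕜] F} {M : ℝ}
    (hT : ∀ i, ‖T i‖ ≤ M) {s : Set E} (hs : ∀ x ∈ s, Tendsto (fun i => T i x) l (𝓝 (T₀ x)))
    {x : E} (hx : x ∈ (Submodule.span 𝕜 s).topologicalClosure) :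
    Tendsto (fun i => T i x) l (𝓝 (T₀ x)) := by
  have hequi : Equicontinuous ((↑) ∘ T : ι → E → F) ↔ ∃ M, ∀ i, ‖T i‖ ≤ M :=
    (NormedSpace.equicontinuous_TFAE T).out 1 5
  refine (hequi.mpr ⟨M, hT⟩ x).tendsto_of_mem_closure T₀.continuous.continuousWithinAt ?_ hx
  intro y hy
  induction hy using Submodule.span_induction with
  | mem y hy => exact hs y hy
  | zero => simpa using tendsto_const_nhds
  | add y z _ _ hy hz => simpa using hy.add hz
  | smul c y _ hy => simpa using hy.const_smul c

end Normed

section Hilbert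

variable {H : Type*} [NormedAddCommGroup H] [InnerProductSpace 𝕜 H]

theorem tendsto_of_norm_le_of_tendsto_inner {x : ι → H} {y : H} (hx : ∀ i, ‖x i‖ ≤ ‖y‖)
    (hinner : Tendsto (fun i => ⟪y, x i⟫_𝕜) l (𝓝 ⟪y, y⟫_𝕜)) : Tendsto x l (𝓝 y) := by
  have hre : Tendsto (fun i => RCLike.re ⟪y, x i⟫_𝕜) l (𝓝 (‖y‖ ^ 2)) := by
    rw [← inner_self_eq_norm_sq (𝕜 := 𝕜)]
    exact (RCLike.continuous_re.tendsto _).comp hinner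
  have hbound (i : ι) : ‖x i - y‖ ^ 2 ≤ 2 * (‖y‖ ^ 2 - RCLike.re ⟪y, x i⟫_𝕜) := by
    have hsq : ‖x i‖ ^ 2 ≤ ‖y‖ ^ 2 := by gcongr; exact hx i
    rw [norm_sub_sq (𝕜 := 𝕜), inner_re_symm]
    linarith
  have hlim : Tendsto (fun i => 2 * (‖y‖ ^ 2 - RCLike.re ⟪y, x i⟫_𝕜)) l (𝓝 0) := by
    have h := (hre.const_sub (‖y‖ ^ 2)).const_mul 2
    rwa [sub_self, mul_zero] at h
  have hsq : Tendsto (fun i => ‖x i - y‖ ^ 2) l (𝓝 0) :=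
    squeeze_zero (fun _ => sq_nonneg _) hbound hlim
  rw [tendsto_iff_norm_sub_tendsto_zero]
  simpa using hsq.sqrt

/-- Douglas' factorization lemma. -/
theorem exists_norm_le_one_comp_eq {E F : Type*} [NormedAddCommGroup E] [NormedSpace 𝕜 E]
    [NormedAddCommGroup F] [NormedSpace 𝕜 F] [CompleteSpace F] [CompleteSpace H]
    {A : E →L[𝕜] H} {B : E →L[𝕜] F} (hBA : ∀ g, ‖B g‖ ≤ ‖A g‖) :
    ∃ C : H →L[𝕜] F, ‖C‖ ≤ 1 ∧ C ∘L A = B := by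
  let R : Submodule 𝕜 H := (LinearMap.range (A : E →ₗ[𝕜] H)).topologicalClosure
  have : CompleteSpace R := (Submodule.isClosed_topologicalClosure _).completeSpace_coe
  have hAR (g : E) : A g ∈ R := Submodule.le_topologicalClosure _ ⟨g, rfl⟩
  let e : E →ₗ[𝕜] R := (A : E →ₗ[𝕜] H).codRestrict R hAR
  have hdense : DenseRange e := fun x => by
    rw [closure_subtype, ← Set.range_comp]
    exact x.2
  have hbound (g : E) : ‖(B : E →ₗ[𝕜] F) g‖ ≤ 1 * ‖e g‖ := by
    rw [one_mul]
    exact hBA g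
  refine ⟨(B : E →ₗ[𝕜] F).extendOfNorm e ∘L R.orthogonalProjectionOnto, ?_, ?_⟩
  · refine (ContinuousLinearMap.opNorm_comp_le _ _).trans (mul_le_one₀ ?_ (norm_nonneg _) ?_)
    · exact LinearMap.opNorm_extendOfNorm_le hdense zero_le_one hbound
    · exact R.orthogonalProjectionOnto_norm_le
  · ext g
    have hproj : R.orthogonalProjectionOnto (A g) = e g :=
      R.orthogonalProjectionOnto_mem_subspace_eq_self (e g)
    rw [ContinuousLinearMap.comp_apply, ContinuousLinearMap.comp_apply, hproj]
    exact LinearMap.extendOfNorm_eq hdense ⟨1, hbound⟩ g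

/-- If `S` leaves `K` invariant then `P⊥ S = P⊥ S P⊥`, where `P⊥` is the projection onto `Kᗮ`. -/
theorem norm_orthogonalProjectionOnto_orthogonal_apply_le {K : Submodule 𝕜 H}
    [K.HasOrthogonalProjection] {S : H →L[𝕜] H} (hS : ‖S‖ ≤ 1) (hK : ∀ x ∈ K, S x ∈ K) (u : H) :
    ‖Kᗮ.orthogonalProjectionOnto (S u)‖ ≤ ‖Kᗮ.orthogonalProjectionOnto u‖ := by
  have hproj : Kᗮ.orthogonalProjectionOnto (S u) =
      Kᗮ.orthogonalProjectionOnto (S (Kᗮ.orthogonalProjectionOnto u)) := by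
    have hzero : Kᗮ.orthogonalProjectionOnto (S (K.orthogonalProjectionOnto u)) = 0 :=
      Submodule.orthogonalProjectionOnto_orthogonal_apply_eq_zero (hK _ (Subtype.mem _))
    conv_lhs => rw [← K.starProjection_add_starProjection_orthogonal u, map_add, map_add]
    exact (congrArg (· + _) hzero).trans (zero_add _)
  rw [hproj]
  refine (Kᗮ.norm_orthogonalProjectionOnto_apply_le _).trans ?_
  simpa using S.le_of_opNorm_le hS (Kᗮ.orthogonalProjectionOnto u : H)

variable [CompleteSpace H]

theorem orthogonal_ker_eq_topologicalClosure_span_range {A : H →L[𝕜] H} (hA : IsSelfAdjoint A) :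
    (LinearMap.ker (A : H →ₗ[𝕜] H))ᗮ = (Submodule.span 𝕜 (Set.range A)).topologicalClosure := by
  have hrange : Set.range A = (LinearMap.range (A : H →ₗ[𝕜] H) : Set H) :=
    (LinearMap.coe_range (A : H →ₗ[𝕜] H)).symm
  rw [hrange, Submodule.span_eq, A.orthogonal_ker, hA.adjoint_eq]

theorem tendsto_adjoint_apply {C : ι → H →L[𝕜] H} (hC : ∀ i, ‖C i‖ ≤ 1) {y : H}
    (hy : Tendsto (fun i => C i y) l (𝓝 y)) : Tendsto (fun i => ((C i)†) y) l (𝓝 y) := by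
  refine tendsto_of_norm_le_of_tendsto_inner (𝕜 := 𝕜) (fun i => ?_) ?_
  · have hCi : ‖(C i)†‖ ≤ 1 := (LinearIsometryEquiv.norm_map _ _).trans_le (hC i)
    simpa using ((C i)†).le_of_opNorm_le hCi y
  · simp_rw [ContinuousLinearMap.adjoint_inner_right]
    exact hy.inner tendsto_const_nhds

end Hilbert

end Operators

section Defect

variable {H : Type*} [NormedAddCommGroup H] [InnerProductSpace ℂ H] [CompleteSpace H]

theorem isSelfAdjoint_sqrtOp (A : H →L[ℂ] H) : IsSelfAdjoint (sqrtOp A) :=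
  IsSelfAdjoint.of_nonneg (CFC.sqrt_nonneg A)

theorem norm_sqrtOp_apply_sq {A : H →L[ℂ] H} (hA : 0 ≤ A) (g : H) :
    ‖sqrtOp A g‖ ^ 2 = RCLike.re ⟪A g, g⟫_ℂ := by
  have hsq : sqrtOp A * sqrtOp A = A := CFC.sqrt_mul_sqrt_self A hA
  have hsymm : ⟪sqrtOp A (sqrtOp A g), g⟫_ℂ = ⟪sqrtOp A g, sqrtOp A g⟫_ℂ :=
    (isSelfAdjoint_sqrtOp A).isSymmetric _ _
  rw [← inner_self_eq_norm_sq (𝕜 := ℂ), ← hsymm]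
  conv_rhs => rw [← hsq]
  rfl

theorem norm_sqrtOp_one_sub_adjoint_mul_self_apply_sq {T : H →L[ℂ] H} (hT : ‖T‖ ≤ 1) (g : H) :
    ‖sqrtOp (1 - T† * T) g‖ ^ 2 = ‖g‖ ^ 2 - ‖T g‖ ^ 2 := by
  have hle : T† * T ≤ 1 := by
    rw [← ContinuousLinearMap.star_eq_adjoint,
      ← CStarAlgebra.norm_le_one_iff_of_nonneg _ (star_mul_self_nonneg T),
      CStarRing.norm_star_mul_self]
    exact mul_le_one₀ hT (norm_nonneg _) hT
  have hinner : ⟪(1 - T† * T) g, g⟫_ℂ = ⟪g, g⟫_ℂ - ⟪T g, T g⟫_ℂ := by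
    rw [← ContinuousLinearMap.adjoint_inner_left, ← inner_sub_left]
    rfl
  rw [norm_sqrtOp_apply_sq (sub_nonneg.mpr hle), hinner, map_sub, inner_self_eq_norm_sq,
    inner_self_eq_norm_sq]

theorem norm_sq_sub_norm_apply_sq_le {S T : H →L[ℂ] H} (hS : ‖S‖ ≤ 1) (hT : ‖T‖ ≤ 1)
    (hST : Commute S (T† * T)) (g : H) :
    ‖S g‖ ^ 2 - ‖T (S g)‖ ^ 2 ≤ ‖g‖ ^ 2 - ‖T g‖ ^ 2 := by
  have hcomm : Commute (sqrtOp (1 - T† * T)) S :=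
    ((Commute.one_right S).sub_right hST).symm.cfcₙ_nnreal NNReal.sqrt
  have happly : sqrtOp (1 - T† * T) (S g) = S (sqrtOp (1 - T† * T) g) :=
    DFunLike.congr_fun hcomm.eq g
  rw [← norm_sqrtOp_one_sub_adjoint_mul_self_apply_sq hT,
    ← norm_sqrtOp_one_sub_adjoint_mul_self_apply_sq hT, happly]
  gcongr
  simpa using S.le_of_opNorm_le hS (sqrtOp (1 - T† * T) g)

theorem norm_sq_sub_norm_orthogonalProjectionOnto_apply_sq_le {K : Submodule ℂ H}
    [K.HasOrthogonalProjection] {S T : H →L[ℂ] H} (hS : ‖S‖ ≤ 1) (hT : ‖T‖ ≤ 1)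
    (hK : ∀ x ∈ K, S x ∈ K) (hST : Commute S T) (hST' : Commute S (T†)) (g : H) :
    ‖S g‖ ^ 2 - ‖K.orthogonalProjectionOnto (T (S g))‖ ^ 2 ≤
      ‖g‖ ^ 2 - ‖K.orthogonalProjectionOnto (T g)‖ ^ 2 := by
  have hdefect := norm_sq_sub_norm_apply_sq_le hS hT (hST'.mul_right hST) g
  have hcomm : T (S g) = S (T g) := (DFunLike.congr_fun hST.eq g).symm
  have horth : ‖Kᗮ.orthogonalProjectionOnto (T (S g))‖ ^ 2 ≤
      ‖Kᗮ.orthogonalProjectionOnto (T g)‖ ^ 2 := by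
    rw [hcomm]
    gcongr
    exact norm_orthogonalProjectionOnto_orthogonal_apply_le hS hK (T g)
  have hpythSg := K.norm_sq_eq_add_norm_sq_projection (T (S g))
  have hpythg := K.norm_sq_eq_add_norm_sq_projection (T g)
  linarith

end Defect

namespace RangeSpace

variable {H : Type*} [NormedAddCommGroup H] [InnerProductSpace ℂ H] [CompleteSpace H]
  {A : H →L[ℂ] H}

theorem norm_mk_apply_le (x : H) (hx : A x ∈ LinearMap.range (A : H →ₗ[ℂ] H)) :
    ‖(mk (A x) hx : RangeSpace A)‖ ≤ ‖x‖ := by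
  let K : Submodule ℂ H := LinearMap.ker (A : H →ₗ[ℂ] H)
  have : CompleteSpace K := A.isClosed_ker.completeSpace_coe
  have hker : A (K.starProjection x) = 0 := K.starProjection_apply_mem x
  have hmk : (mk (A x) hx : RangeSpace A) = coimageMap A (Kᗮ.orthogonalProjectionOnto x) := by
    refine Subtype.ext ?_
    change A x = A (Kᗮ.starProjection x)
    rw [Submodule.starProjection_orthogonal_val, map_sub, hker, sub_zero]
  rw [hmk, norm_coimageMap]
  exact Kᗮ.norm_starProjection_apply_le x

theorem exists_tendsto_norm_mk_adjoint_apply_sub {ι : Type*} {l : Filter ι}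
    (hA : IsSelfAdjoint A) {S : ι → H →L[ℂ] H} (hAS : ∀ i g, ‖A (S i g)‖ ≤ ‖A g‖)
    (hS : ∀ g, Tendsto (fun i => S i g) l (𝓝 g)) (f : RangeSpace A) :
    ∃ hmem : ∀ i, ((S i)†) f.val ∈ LinearMap.range (A : H →ₗ[ℂ] H),
      Tendsto (fun i => ‖(mk (((S i)†) f.val) (hmem i) : RangeSpace A) - f‖) l (𝓝 0) := by
  obtain ⟨y, rfl⟩ := (bijective_coimageMap A).2 f
  choose C hC hCA using fun i => exists_norm_le_one_comp_eq (A := A) (B := A ∘L S i) (hAS i)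
  have hadj (i : ι) : A (((C i)†) y) = ((S i)†) (A y) := by
    have h := congrArg (fun T => T†) (hCA i)
    simp only [ContinuousLinearMap.adjoint_comp, hA.adjoint_eq] at h
    exact DFunLike.congr_fun h (y : H)
  have hy : (y : H) ∈ (Submodule.span ℂ (Set.range A)).topologicalClosure :=
    orthogonal_ker_eq_topologicalClosure_span_range hA ▸ y.2
  have hCy : Tendsto (fun i => C i y) l (𝓝 (y : H)) := by
    refine tendsto_apply_of_mem_closure_span (T₀ := .id ℂ H) hC ?_ hy
    rintro _ ⟨g, rfl⟩
    have hCAg (i : ι) : C i (A g) = A (S i g) := DFunLike.congr_fun (hCA i) g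
    simp_rw [hCAg]
    exact (A.continuous.tendsto g).comp (hS g)
  have hlim := tendsto_iff_norm_sub_tendsto_zero.mp (tendsto_adjoint_apply hC hCy)
  refine ⟨fun i => ⟨_, hadj i⟩, squeeze_zero (fun _ => norm_nonneg _) (fun i => ?_) hlim⟩
  have hsub : (mk (((S i)†) (coimageMap A y).val) ⟨_, hadj i⟩ : RangeSpace A) - coimageMap A y =
      mk (A (((C i)†) y - y)) ⟨_, rfl⟩ := by
    refine Subtype.ext ?_
    change ((S i)†) (A y) - A y = A (((C i)†) y - y)
    rw [map_sub, hadj]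
  rw [hsub]
  exact norm_mk_apply_le _ _

end RangeSpace

section Multiplication

theorem coeFn_mulOp (ψ : LInf) (g : L2) :
    (mulOp ψ g : Torus → ℂ) =ᵐ[torusMeasure] fun x => ψ x * g x :=
  (ContinuousLinearMap.mul ℂ ℂ).coeFn_holder (r := 2) ψ g

theorem norm_mulOp_le (ψ : LInf) : ‖mulOp ψ‖ ≤ ‖ψ‖ := by
  have hmul : ‖(ContinuousLinearMap.mul ℂ ℂ).holderL torusMeasure ∞ 2 2‖ ≤ 1 :=
    (ContinuousLinearMap.norm_holderL_le _).trans (ContinuousLinearMap.opNorm_mul_le ℂ ℂ)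
  exact (ContinuousLinearMap.le_of_opNorm_le _ hmul ψ).trans_eq (one_mul _)

theorem adjoint_mulOp (ψ : LInf) : (mulOp ψ)† = mulOp (star ψ) := by
  refine ((ContinuousLinearMap.eq_adjoint_iff _ _).mpr fun f g => ?_).symm
  rw [L2.inner_def, L2.inner_def]
  refine integral_congr_ae ?_
  filter_upwards [coeFn_mulOp (star ψ) f, coeFn_mulOp ψ g, Lp.coeFn_star ψ] with x hf hg hψ
  rw [hf, hg, hψ]
  simp only [RCLike.inner_apply, Pi.star_apply, map_mul, RCLike.star_def, RCLike.conj_conj]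
  ring

theorem commute_mulOp (φ ψ : LInf) : Commute (mulOp φ) (mulOp ψ) := by
  refine ContinuousLinearMap.ext fun g => Lp.ext ?_
  change mulOp φ (mulOp ψ g) =ᵐ[torusMeasure] mulOp ψ (mulOp φ g)
  filter_upwards [coeFn_mulOp φ (mulOp ψ g), coeFn_mulOp ψ (mulOp φ g), coeFn_mulOp φ g,
    coeFn_mulOp ψ g] with x hφψ hψφ hφ hψ
  rw [hφψ, hψφ, hφ, hψ]
  ring

theorem inner_fourierLp_mulOp_fourierLp (ψ : LInf) (m k : ℤ) :
    ⟪(fourierLp 2 m : L2), mulOp ψ (fourierLp 2 k)⟫_ℂ = fourierCoeff (ψ : Torus → ℂ) (m - k) := by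
  rw [L2.inner_def]
  refine integral_congr_ae ?_
  filter_upwards [coeFn_mulOp ψ (fourierLp 2 k), coeFn_fourierLp 2 m, coeFn_fourierLp 2 k]
    with x hmul hm hk
  rw [hmul, hm, hk, neg_sub, sub_eq_add_neg, fourier_add, fourier_neg, RCLike.inner_apply,
    smul_eq_mul]
  ring

theorem tendsto_mulOp_apply {ι : Type*} {l : Filter ι} {ψ : ι → LInf} (hψ : ∀ i, ‖ψ i‖ ≤ 1)
    (hcoeff : Tendsto (fun i => fourierCoeff (ψ i : Torus → ℂ) 0) l (𝓝 1)) (g : L2) :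
    Tendsto (fun i => mulOp (ψ i) g) l (𝓝 g) := by
  have hop (i : ι) : ‖mulOp (ψ i)‖ ≤ 1 := (norm_mulOp_le _).trans (hψ i)
  have hg : g ∈ (Submodule.span ℂ (Set.range (fourierLp 2 : ℤ → L2))).topologicalClosure := by
    rw [span_fourierLp_closure_eq_top (by simp)]
    trivial
  refine tendsto_apply_of_mem_closure_span (T₀ := .id ℂ L2) hop ?_ hg
  rintro _ ⟨k, rfl⟩
  refine tendsto_of_norm_le_of_tendsto_inner (𝕜 := ℂ) (fun i => ?_) ?_
  · simpa using (mulOp (ψ i)).le_of_opNorm_le (hop i) (fourierLp 2 k)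
  · have hself : ⟪(fourierLp 2 k : L2), fourierLp 2 k⟫_ℂ = 1 :=
      inner_self_eq_one_of_norm_eq_one (orthonormal_fourier.1 k)
    simpa only [inner_fourierLp_mulOp_fourierLp, sub_self, ContinuousLinearMap.id_apply, hself]
      using hcoeff

theorem mem_H2_iff_inner_fourierLp {g : L2} :
    g ∈ H2 ↔ ∀ n : ℤ, n < 0 → ⟪(fourierLp 2 n : L2), g⟫_ℂ = 0 := by
  have hcoeff (n : ℤ) : ⟪(fourierLp 2 n : L2), g⟫_ℂ = fourierCoeff (g : Torus → ℂ) n := by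
    rw [← fourierBasis_repr, HilbertBasis.repr_apply_apply, coe_fourierBasis]
  simp_rw [hcoeff]
  rfl

theorem mulOp_mem_H2 (h : HInf) {g : L2} (hg : g ∈ H2) : mulOp h g ∈ H2 := by
  rw [mem_H2_iff_inner_fourierLp] at hg ⊢
  intro m hm
  rw [← ContinuousLinearMap.adjoint_inner_left,
    ← (fourierBasis (T := 2 * Real.pi)).tsum_inner_mul_inner]
  refine (tsum_congr fun k => ?_).trans tsum_zero
  rw [coe_fourierBasis, ContinuousLinearMap.adjoint_inner_left, inner_fourierLp_mulOp_fourierLp]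
  rcases lt_or_ge k 0 with hk | hk
  · rw [hg k hk, mul_zero]
  · rw [h.2 (m - k) (by omega), zero_mul]

end Multiplication

section Toeplitz

theorem coe_toeplitz_apply (h : HInf) (g : H2) : (toeplitz (h : LInf) g : L2) = mulOp h g :=
  H2.starProjection_eq_self_iff.mpr (mulOp_mem_H2 h g.2)

theorem adjoint_toeplitz (ψ : LInf) : (toeplitz ψ)† = toeplitz (star ψ) := by
  rw [toeplitz, ContinuousLinearMap.adjoint_comp, ContinuousLinearMap.adjoint_comp, adjoint_mulOp,
    Submodule.adjoint_subtypeL, Submodule.adjoint_orthogonalProjectionOnto]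
  rfl

theorem norm_toeplitz_le (ψ : LInf) : ‖toeplitz ψ‖ ≤ ‖ψ‖ := by
  refine ContinuousLinearMap.opNorm_le_bound _ (norm_nonneg ψ) fun g => ?_
  exact (H2.norm_orthogonalProjectionOnto_apply_le _).trans
    ((mulOp ψ).le_of_opNorm_le (norm_mulOp_le ψ) g)

theorem evalDisk_zero (h : HInf) : evalDisk h 0 = fourierCoeff ((h : LInf) : Torus → ℂ) 0 := by
  rw [evalDisk, tsum_eq_single 0 fun n hn => by simp [hn]]
  simp

theorem tendsto_toeplitz_apply {ι : Type*} {l : Filter ι} {h : ι → HInf} (hnorm : ∀ i, ‖h i‖ ≤ 1)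
    (hzero : Tendsto (fun i => evalDisk (h i) 0) l (𝓝 1)) (g : H2) :
    Tendsto (fun i => toeplitz (h i : LInf) g) l (𝓝 g) := by
  simp_rw [evalDisk_zero] at hzero
  rw [tendsto_subtype_rng]
  simp_rw [coe_toeplitz_apply]
  exact tendsto_mulOp_apply hnorm hzero (g : L2)

/-- The operator `(I - T_ψ T_ψ̄)^{1/2}` on `H²` for a bounded symbol `ψ`, not necessarily analytic;
for `b ∈ H^∞` it is `defectOp b`. -/
noncomputable def toeplitzDefectOp (ψ : LInf) : H2 →L[ℂ] H2 :=
  sqrtOp (1 - toeplitz ψ * toeplitz (star ψ))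

theorem norm_toeplitzDefectOp_apply_sq {ψ : LInf} (hψ : ‖ψ‖ ≤ 1) (g : H2) :
    ‖toeplitzDefectOp ψ g‖ ^ 2 = ‖g‖ ^ 2 - ‖toeplitz (star ψ) g‖ ^ 2 := by
  have hT : ‖toeplitz (star ψ)‖ ≤ 1 := by
    rw [← adjoint_toeplitz, LinearIsometryEquiv.norm_map]
    exact (norm_toeplitz_le ψ).trans hψ
  have hadj : toeplitz ψ = (toeplitz (star ψ))† := by rw [adjoint_toeplitz, star_star]
  rw [toeplitzDefectOp, hadj]
  exact norm_sqrtOp_one_sub_adjoint_mul_self_apply_sq hT g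

theorem norm_toeplitzDefectOp_toeplitz_apply_le {ψ : LInf} {h : HInf} (hψ : ‖ψ‖ ≤ 1)
    (hh : ‖h‖ ≤ 1) (g : H2) :
    ‖toeplitzDefectOp ψ (toeplitz (h : LInf) g)‖ ≤ ‖toeplitzDefectOp ψ g‖ := by
  have hS : ‖mulOp (h : LInf)‖ ≤ 1 := (norm_mulOp_le _).trans hh
  have hT : ‖mulOp (star ψ)‖ ≤ 1 := by
    rw [← adjoint_mulOp, LinearIsometryEquiv.norm_map]
    exact (norm_mulOp_le ψ).trans hψ
  have hadj : Commute (mulOp (h : LInf)) ((mulOp (star ψ))†) := by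
    rw [adjoint_mulOp]
    exact commute_mulOp _ _
  have hle := norm_sq_sub_norm_orthogonalProjectionOnto_apply_sq_le (K := H2) hS hT
    (fun _ => mulOp_mem_H2 h) (commute_mulOp _ _) hadj g
  rw [← coe_toeplitz_apply] at hle
  rw [← sq_le_sq₀ (norm_nonneg _) (norm_nonneg _), norm_toeplitzDefectOp_apply_sq hψ,
    norm_toeplitzDefectOp_apply_sq hψ]
  exact hle

end Toeplitz

end DBR

theorem theoremT_general {ι : Type*} {l : Filter ι} (h : ι → DBR.HInf) (hnorm : ∀ i, ‖h i‖ ≤ 1)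
    (hzero : Filter.Tendsto (fun i => DBR.evalDisk (h i) 0) l (nhds 1))
    (b : DBR.LInf) (hb : ‖b‖ ≤ 1) (f : DBR.RangeSpace (DBR.toeplitzDefectOp b)) :
    ∃ hmem : ∀ i, DBR.toeplitz (star (h i : DBR.LInf)) f.val ∈
        LinearMap.range (DBR.toeplitzDefectOp b : DBR.H2 →ₗ[ℂ] DBR.H2),
      Filter.Tendsto
        (fun i => ‖(DBR.RangeSpace.mk (DBR.toeplitz (star (h i : DBR.LInf)) f.val) (hmem i) :
          DBR.RangeSpace (DBR.toeplitzDefectOp b)) - f‖)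
        l (nhds 0) := by
  simp_rw [← DBR.adjoint_toeplitz]
  exact DBR.RangeSpace.exists_tendsto_norm_mk_adjoint_apply_sub (DBR.isSelfAdjoint_sqrtOp _)
    (fun i => DBR.norm_toeplitzDefectOp_toeplitz_apply_le hb (hnorm i))
    (DBR.tendsto_toeplitz_apply hnorm hzero) f

theorem theoremT (h : ℕ → DBR.HInf) (hnorm : ∀ n, ‖h n‖ ≤ 1)
    (hzero : Filter.Tendsto (fun n => DBR.evalDisk (h n) 0) Filter.atTop (nhds 1))
    (b : DBR.HInf) (hb : ‖b‖ ≤ 1) (f : DBR.DeBrangesRovnyak b) :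
    ∃ hmem : ∀ n, DBR.toeplitz (star (h n : DBR.LInf)) f.val ∈ DBR.deBrangesRovnyakSubmodule b,
      Filter.Tendsto
        (fun n => ‖(DBR.RangeSpace.mk (DBR.toeplitz (star (h n : DBR.LInf)) f.val) (hmem n) :
          DBR.DeBrangesRovnyak b) - f‖)
        Filter.atTop (nhds 0) :=
  theoremT_general h hnorm hzero b hb f
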